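/- Let $\alpha>-1$. For a real number $x$ and an integer $k\ge0$ let $(x)_k=x(x+1)\cdots(x+k-1)$ and $\binom{x}{k}=\frac{x(x-1)\cdots(x-k+1)}{k!}$, and let $\binom{x}{k}=0$ for integers $k<0$. For every real $\beta$ let $$P_n^{(\beta,\beta)}(x)=\sum_{k=0}^n\frac{(n+2\beta+1)_k}{k!}\frac{(\beta+k+1)_{n-k}}{(n-k)!}\left(\frac{x-1}{2}\right)^k,\qquad n=0,1,2,\ldots$$ be the classical ultraspherical polynomials. For $M\ge 0$ the symmetric generalized ultraspherical polynomials are $$P_n^{\alpha,\alpha,M,M}(x)=C_0P_n^{(\alpha,\alpha)}(x)-C_1\,x\,\frac{d}{dx}P_n^{(\alpha,\alpha)}(x),\qquad n=0,1,2,\ldots,$$ $$C_0=1+\frac{2Mn}{\alpha+1}\binom{n+2\alpha+1}{n}+4M^2\binom{n+2\alpha+1}{n-1}^2,\qquad C_1=\frac{2M}{2\alpha+1}\binom{n+2\alpha}{n}+\frac{2M^2}{\alpha+1}\binom{n+2\alpha}{n-1}\binom{n+2\alpha+1}{n},$$ where the case $2\alpha+1=0$ is understood by continuity. Consider the differential equations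 $$M\sum_{i=0}^{\infty}a_i(x)y^{(i)}(x)+(1-x^2)y''(x)-2(\alpha+1)xy'(x)+n(n+2\alpha+1)y(x)=0,\qquad(*)$$ where $a_0(x)=a_0(n,\alpha)$ does not depend on $x$, the real functions $a_1,a_2,\ldots$ on $\mathbb R$ do not depend on $n$, and none of the coefficients $a_0,a_1,a_2,\ldots$ depends on $M$. (i) If $y=P_n^{\alpha,\alpha,M,M}$ satisfies $(*)$ for all $x\in\mathbb R$, for all $M\ge0$ and all $n=0,1,2,\ldots$, then $$a_0(n,\alpha)=a_0(1,\alpha)\,\tfrac12\left[1-(-1)^n\right]+4(2\alpha+3)\binom{n+2\alpha+2}{n-2},\qquad n=0,1,2,\ldots,$$ $$a_i(x)=a_0(1,\alpha)\,\frac{2^{i-1}}{i!}(-x)^i+c_i(x),\qquad i=1,2,3,\ldots,$$ where $c_1(x)=0$ and $$c_i(x)=(2\alpha+3)(1-x^2)\frac{2^i}{i!}P_{i-2}^{(\alpha-i+3,\alpha-i+3)}(x),\qquad i=2,3,4,\ldots.$$ (ii) The value $a_0(1,\alpha)$ is arbitrary: for every real number $t$, the coefficients given by these formulas with $a_0(1,\alpha)=t$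 are such that $y=P_n^{\alpha,\alpha,M,M}$ satisfies $(*)$ for all $x\in\mathbb R$, all $M\ge0$ and all $n=0,1,2,\ldots$. -/

import Mathlib

open Polynomial

noncomputable section

namespace GenUltraspherical

/-- Shifted factorial `(x)_k = x (x+1) ⋯ (x+k-1)`. -/
def poch (x : ℝ) (k : ℕ) : ℝ := (ascPochhammer ℝ k).eval x

/-- Binomial coefficient with real upper entry and integer lower entry;
it is `0` when the lower entry is negative. -/
def binom (x : ℝ) (k : ℤ) : ℝ := if k < 0 then 0 else Ring.choose x k.toNat

/-- The classical ultraspherical polynomial `P_n^{(α,α)}`, for every real `α`. -/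
def ultra (n : ℕ) (α : ℝ) : ℝ[X] :=
  ∑ k ∈ Finset.range (n + 1),
    C (poch (n + 2 * α + 1) k / (k.factorial : ℝ) *
        (poch (α + k + 1) (n - k) / ((n - k).factorial : ℝ))) *
      (C (1 / 2 : ℝ) * (X - 1)) ^ k

/-- The quantity `binom (n + 2α) n / (2α + 1)`, extended by continuity to `2α + 1 = 0`
for `n ≥ 1` (see `dividedBinom_eq` and `continuous_dividedBinom`). -/
def dividedBinom (α : ℝ) : ℕ → ℝ
  | 0 => 1 / (2 * α + 1)
  | n + 1 => poch (2 * α + 2) n / ((n + 1).factorial : ℝ)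

theorem dividedBinom_eq (α : ℝ) (n : ℕ) (h : 2 * α + 1 ≠ 0) :
    dividedBinom α n = binom (n + 2 * α) n / (2 * α + 1) := by
  have hb : binom (n + 2 * α) n = poch (2 * α + 1) n / (n.factorial : ℝ) := by
    have h1 := Ring.descPochhammer_eq_factorial_smul_choose ((n : ℝ) + 2 * α) n
    rw [descPochhammer_smeval_eq_ascPochhammer, ascPochhammer_smeval_eq_eval, nsmul_eq_mul] at h1
    have h2 : (n : ℝ) + 2 * α - n + 1 = 2 * α + 1 := by ring
    rw [h2] at h1
    have h3 : (n.factorial : ℝ) ≠ 0 := by positivity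
    unfold binom poch
    rw [if_neg (by omega), Int.toNat_natCast, h1]
    field_simp
  rw [hb]
  cases n with
  | zero => simp [dividedBinom, poch]
  | succ n =>
    have h4 : poch (2 * α + 1) (n + 1) = (2 * α + 1) * poch (2 * α + 2) n := by
      unfold poch
      rw [ascPochhammer_succ_left, eval_mul, eval_comp]
      simp only [eval_X, eval_add, eval_one]
      ring_nf
    simp only [dividedBinom]
    rw [h4]
    field_simp

theorem continuous_dividedBinom (n : ℕ) : Continuous fun α : ℝ => dividedBinom α (n + 1) := by
  simp only [dividedBinom, poch]
  fun_prop

/-- The constant `C₀`. -/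
def C0 (n : ℕ) (α M : ℝ) : ℝ :=
  1 + 2 * M * n / (α + 1) * binom (n + 2 * α + 1) n
    + 4 * M ^ 2 * binom (n + 2 * α + 1) ((n : ℤ) - 1) ^ 2

/-- The constant `C₁`. For `n = 0` its value is irrelevant, since it multiplies
`x D P_0^{(α,α)} = 0`. -/
def C1 (n : ℕ) (α M : ℝ) : ℝ :=
  2 * M * dividedBinom α n
    + 2 * M ^ 2 / (α + 1) * binom (n + 2 * α) ((n : ℤ) - 1) * binom (n + 2 * α + 1) n

/-- The symmetric generalized ultraspherical polynomial `P_n^{α,α,M,M}`. -/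
def genUltra (n : ℕ) (α M : ℝ) : ℝ[X] :=
  C (C0 n α M) * ultra n α - C (C1 n α M) * (X * derivative (ultra n α))

/-- The polynomial `y` satisfies the differential equation
`M ∑_{i ≥ 0} a_i(x) y^{(i)}(x) + (1-x²) y''(x) - 2(α+1) x y'(x) + n(n+2α+1) y(x) = 0`
for all real `x`, with `a_0 = a₀ n` constant in `x` and `a_i = a i` for `i ≥ 1`
(the value `a 0` is not used). The series has finitely many nonzero terms. -/
def SatisfiesDE (α M : ℝ) (a₀ : ℕ → ℝ) (a : ℕ → ℝ → ℝ) (n : ℕ) (y : ℝ[X]) : Prop :=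
  ∀ x : ℝ,
    M * (a₀ n * y.eval x + ∑' i : ℕ, a (i + 1) x * (derivative^[i + 1] y).eval x)
      + (1 - x ^ 2) * (derivative^[2] y).eval x
      - 2 * (α + 1) * x * (derivative y).eval x
      + n * (n + 2 * α + 1) * y.eval x = 0

theorem summable_series (a : ℕ → ℝ → ℝ) (y : ℝ[X]) (x : ℝ) :
    Summable fun i : ℕ => a (i + 1) x * (derivative^[i + 1] y).eval x := by
  refine summable_of_ne_finset_zero (s := Finset.range y.natDegree) fun i hi => ?_
  rw [iterate_derivative_eq_zero (by simp at hi; omega)]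
  simp

def b₀ (n : ℕ) : ℝ := 1 / 2 * (1 - (-1) ^ n)

def c₀ (α : ℝ) (n : ℕ) : ℝ := 4 * (2 * α + 3) * binom (n + 2 * α + 2) ((n : ℤ) - 2)

/-- `b_i(x)`, used for `i ≥ 1`. -/
def b (i : ℕ) (x : ℝ) : ℝ := 2 ^ (i - 1) / (i.factorial : ℝ) * (-x) ^ i

/-- `c_i(x)`, used for `i ≥ 1`. -/
def c (α : ℝ) (i : ℕ) (x : ℝ) : ℝ :=
  if i ≤ 1 then 0
  else (2 * α + 3) * (1 - x ^ 2) * (2 ^ i / (i.factorial : ℝ)) *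
    (ultra (i - 2) (α - i + 3)).eval x

end GenUltraspherical

end

namespace GenUltraspherical

/-! Write Q = `ultra n α`, λ = n(n+2α+1), ρ = `dividedBinom α n` and σ = ρλ/(α+1). Then C₀ = (1+Mσ)²
and C₁ = 2Mρ(1+Mσ), and the ultraspherical equation for Q collapses the second-order part of (*) to
-2C₁Q''. After division by M(1+Mσ) the rest is affine in M. So, with A = a₀ + ∑ aᵢDⁱ, (*) for all M
≥ 0 amounts to two equations free of M: AQ = 4ρQ'' and A(xQ') = 2σQ'' (`satisfiesDE_genUltra_iff`,
`diffOp_of_satisfiesDE`).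

Uniqueness (`eq_zero_of_diffOp_eq_zero`): the difference of two solutions with the same a₀(1)
annihilates Q and xQ' for every n. Since nQ - xQ' has degree below n, induction leaves only the
zeroth-order term acting on it. This polynomial is nonzero for n ≥ 2 and zero for n = 1, whence the
freedom in a₀(1). Then AQ = 0 reduces to the n-th coefficient times the nonzero constant Q⁽ⁿ⁾.

Existence: by Taylor's formula the b-part is y ↦ b₀(n)y + (y(-x) - y(x))/2, which kills polynomials
of parity (-1)ⁿ. The c-part is y ↦ c₀y + 4(2α+3)(1-x²) ∑ G_j y⁽ʲ⁺²⁾/(j+2)!, where G_j are the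
coefficients of (1+2xw+(x²-1)w²)^(α+1) in w. With exponent α instead, the sum applied to Q is a
multiple of Q'' (`genSum_ultra`): both solve the equation of parameter α+2, have degree at most n-2,
and agree in the coefficient of xⁿ⁻² by Vandermonde. Recurrences for G_j lead to exponent α+1, and
the equation for Q does the rest. -/

theorem poch_succ_left (x : ℝ) (k : ℕ) : poch x (k + 1) = x * poch (x + 1) k := by
  simp [poch, ascPochhammer_succ_left, eval_comp]

theorem poch_succ_right (x : ℝ) (k : ℕ) : poch x (k + 1) = poch x k * (x + k) := by
  simp [poch, ascPochhammer_succ_right]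

@[simp]
theorem poch_zero (x : ℝ) : poch x 0 = 1 := by simp [poch]

theorem poch_pos {x : ℝ} (hx : 0 < x) (k : ℕ) : 0 < poch x k := ascPochhammer_pos k x hx

theorem choose_eq_poch (y : ℝ) (k : ℕ) :
    Ring.choose y k = poch (y - k + 1) k / (k.factorial : ℝ) := by
  have h1 := Ring.descPochhammer_eq_factorial_smul_choose y k
  rw [descPochhammer_smeval_eq_ascPochhammer, ascPochhammer_smeval_eq_eval, nsmul_eq_mul] at h1
  have h3 : (k.factorial : ℝ) ≠ 0 := by positivity
  rw [poch, h1]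
  field_simp

theorem binom_natCast (y : ℝ) (k : ℕ) :
    binom y k = poch (y - k + 1) k / (k.factorial : ℝ) := by
  rw [← choose_eq_poch, binom, if_neg (by omega), Int.toNat_natCast]

/-- Induction device: an identity whose derivative is a multiple of its predecessor need only be
checked at x = 1. -/
theorem eq_zero_of_derivative_eq_zero_of_eval_one {p : ℝ[X]} (h : derivative p = 0)
    (h1 : p.eval 1 = 0) : p = 0 := by
  rw [eq_C_of_natDegree_eq_zero (derivative_eq_zero.mp h)] at h1 ⊢
  rw [eval_C] at h1
  rw [h1, C_0]

/-! ### Ultraspherical polynomials: derivatives, differential equation, parity -/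

theorem derivative_ultra_succ (n : ℕ) (β : ℝ) :
    derivative (ultra (n + 1) β) = C ((n + 2 * β + 2) / 2) * ultra n (β + 1) := by
  simp only [ultra]
  rw [Finset.sum_range_succ', derivative_add, derivative_sum, Finset.mul_sum]
  simp only [pow_zero, mul_one, derivative_C, add_zero]
  refine Finset.sum_congr rfl fun k hk => ?_
  rw [derivative_C_mul, derivative_pow]
  have hd : derivative (C (1 / 2 : ℝ) * (X - 1)) = C (1 / 2 : ℝ) := by simp
  rw [hd, Nat.add_sub_cancel, ← mul_assoc (C _) (C _) (_ ^ _)]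
  rw [show ∀ (a b c d : ℝ) (p : ℝ[X]), C a * (C b * p * C c) = C (a * b * c) * p from
    fun a b c d p => by simp only [C_mul]; ring]
  · rw [← C_mul]
    congr 2
    rw [poch_succ_left, show n + 1 - (k + 1) = n - k by omega, Nat.factorial_succ]
    have h1 : (k.factorial : ℝ) ≠ 0 := by positivity
    have h2 : ((n - k).factorial : ℝ) ≠ 0 := by positivity
    push_cast
    rw [show (n : ℝ) + 1 + 2 * β + 1 = n + 2 * β + 2 by ring,
      show (n : ℝ) + 2 * (β + 1) + 1 = n + 2 * β + 2 + 1 by ring,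
      show β + (k + 1) + 1 = β + 1 + k + 1 by ring]
    field_simp
  · exact 0

theorem eval_one_ultra (n : ℕ) (β : ℝ) :
    (ultra n β).eval 1 = poch (β + 1) n / (n.factorial : ℝ) := by
  rw [ultra, eval_finsetSum, Finset.sum_eq_single 0]
  · simp
  · intro k _ hk
    simp [hk]
  · simp

theorem natDegree_ultra_le (n : ℕ) (β : ℝ) : (ultra n β).natDegree ≤ n := by
  refine natDegree_sum_le_of_forall_le _ _ fun k hk => ?_
  have hk : k < n + 1 := by simpa using hk
  refine (natDegree_C_mul_le _ _).trans ?_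
  refine (natDegree_pow_le_of_le k (m := 1) ?_).trans (by omega)
  refine (natDegree_C_mul_le _ _).trans ?_
  rw [← C_1]
  exact (natDegree_X_sub_C (1 : ℝ)).le

theorem ultra_zero (β : ℝ) : ultra 0 β = 1 := by simp [ultra]

theorem coeff_ultra_pos (n : ℕ) : ∀ β : ℝ, -1 < β → 0 < (ultra n β).coeff n := by
  induction n with
  | zero => intro β _; simp [ultra_zero]
  | succ n ih =>
    intro β hβ
    have h := congrArg (fun p => coeff p n) (derivative_ultra_succ n β)
    simp only [coeff_derivative, coeff_C_mul] at h
    have h1 := ih (β + 1) (by linarith)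
    have h2 : (0 : ℝ) < (n + 2 * β + 2) / 2 := by
      have : (0 : ℝ) ≤ n := by positivity
      linarith
    have h3 : (0 : ℝ) < n + 1 := by positivity
    have h4 := mul_pos h2 h1
    rw [← h] at h4
    exact pos_of_mul_pos_left h4 h3.le

/-- Differentiating the equation for (n+1, β) gives a multiple of the one for (n, β+1), so β varies
in the induction. -/
theorem ultra_ode (n : ℕ) : ∀ β : ℝ,
    (1 - X ^ 2) * derivative (derivative (ultra n β))
      - C (2 * (β + 1)) * X * derivative (ultra n β)
      + C (n * (n + 2 * β + 1)) * ultra n β = 0 := by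
  induction n with
  | zero => intro β; simp [ultra_zero]
  | succ n ih =>
    intro β
    apply eq_zero_of_derivative_eq_zero_of_eval_one
    · have h := ih (β + 1)
      rw [derivative_ultra_succ]
      simp only [derivative_add, derivative_sub, derivative_mul, derivative_C, derivative_X,
        derivative_one, derivative_X_pow, derivative_ultra_succ, zero_mul, zero_add, zero_sub]
      have h' := congrArg (fun p => C (((n : ℝ) + 2 * β + 2) / 2) * p) h
      simp only [mul_zero] at h'
      rw [← h']
      push_cast
      simp only [C_mul, C_add, C_1, map_ofNat, pow_one, map_natCast]
      ring
    · simp only [derivative_ultra_succ, eval_add, eval_sub, eval_mul, eval_C, eval_X, eval_pow,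
        eval_one, eval_one_ultra, poch_succ_left, Nat.factorial_succ]
      have h1 : (n.factorial : ℝ) ≠ 0 := by positivity
      push_cast
      field_simp
      ring

theorem ultra_ode_iterate (n : ℕ) (β : ℝ) (k : ℕ) :
    (1 - X ^ 2) * derivative^[k + 2] (ultra n β)
      - C (2 * (β + k + 1)) * X * derivative^[k + 1] (ultra n β)
      + C (n * (n + 2 * β + 1) - k * (k + 2 * β + 1)) * derivative^[k] (ultra n β) = 0 := by
  induction k with
  | zero => simpa using ultra_ode n β
  | succ k ih =>
    have h := congrArg derivative ih
    rw [derivative_zero] at h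
    rw [← h]
    simp only [derivative_add, derivative_sub, derivative_mul, derivative_C, derivative_X,
      derivative_one, derivative_X_pow, zero_mul, zero_add, zero_sub,
      ← Function.iterate_succ_apply' derivative]
    push_cast
    simp only [C_mul, C_add, C_sub, C_1, map_ofNat, pow_one, map_natCast]
    ring

theorem coeff_of_ode {p : ℝ[X]} {β μ : ℝ}
    (h : (1 - X ^ 2) * derivative (derivative p) - C (2 * (β + 1)) * X * derivative p
      + C μ * p = 0) (k : ℕ) :
    (k + 2) * (k + 1) * p.coeff (k + 2) + (μ - k * (k + 2 * β + 1)) * p.coeff k = 0 := by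
  have h1 := congrArg (fun q => coeff q k) h
  simp only [sub_mul, one_mul, coeff_add, coeff_sub, mul_assoc, coeff_C_mul, coeff_zero] at h1
  rcases k with _ | _ | k
  · simp [coeff_derivative] at h1 ⊢
    linarith
  · simp [coeff_derivative, coeff_X_pow_mul', coeff_X_mul] at h1 ⊢
    linarith
  · simp only [coeff_derivative, coeff_X_pow_mul, coeff_X_mul] at h1
    push_cast at h1 ⊢
    linarith

/-- If p had degree k < m, its top coefficient would give (m-k)(m+k+2β+1) = 0, but both factors are
positive for β > -1. -/
theorem eq_zero_of_ode {p : ℝ[X]} {β : ℝ} {m : ℕ} (hβ : -1 < β)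
    (h : (1 - X ^ 2) * derivative (derivative p) - C (2 * (β + 1)) * X * derivative p
      + C (m * (m + 2 * β + 1)) * p = 0)
    (hd : p.natDegree ≤ m) (hm : p.coeff m = 0) : p = 0 := by
  by_contra hp
  have hlt : p.natDegree < m := by
    refine lt_of_le_of_ne hd fun he => ?_
    rw [← he] at hm
    exact hp (leadingCoeff_eq_zero.mp hm)
  have h1 := coeff_of_ode h p.natDegree
  rw [coeff_eq_zero_of_natDegree_lt (show p.natDegree < p.natDegree + 2 by omega), mul_zero,
    zero_add] at h1
  set k := p.natDegree with hk
  have hk1 : (k : ℝ) + 1 ≤ m := by exact_mod_cast hlt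
  have hk0 : (0 : ℝ) ≤ k := by positivity
  rcases mul_eq_zero.mp h1 with h2 | h2
  · have h3 : ((m : ℝ) - k) * (m + k + 2 * β + 1) = 0 := by linear_combination h2
    rcases mul_eq_zero.mp h3 with h4 | h4 <;> linarith
  · exact hp (leadingCoeff_eq_zero.mp h2)

/-- The differential equation is invariant under x ↦ -x, and the two sides agree in the coefficient
of xⁿ. -/
theorem ultra_comp_neg (n : ℕ) {β : ℝ} (hβ : -1 < β) :
    (ultra n β).comp (-X) = C ((-1) ^ n) * ultra n β := by
  rw [← sub_eq_zero]
  have hc (k : ℕ) : ((ultra n β).comp (-X)).coeff k = (-1) ^ k * (ultra n β).coeff k := by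
    rw [show (-X : ℝ[X]) = C (-1) * X by simp, comp_C_mul_X_coeff, mul_comm]
  refine eq_zero_of_ode (m := n) hβ ?_ ?_ ?_
  · have h := ultra_ode n β
    have h' := congrArg (fun p => p.comp (-X)) h
    simp only [add_comp, sub_comp, mul_comp, C_comp, X_comp, one_comp, pow_comp, zero_comp] at h'
    have e1 : derivative ((ultra n β).comp (-X)) = -(derivative (ultra n β)).comp (-X) := by
      simp [derivative_comp]
    have e2 : derivative ((derivative (ultra n β)).comp (-X))
        = -(derivative (derivative (ultra n β))).comp (-X) := by
      simp [derivative_comp]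
    simp only [derivative_sub, derivative_C_mul, derivative_neg, e2, e1]
    linear_combination h' - C ((-1) ^ n) * h
  · refine (natDegree_sub_le _ _).trans (max_le ?_ ?_)
    · refine natDegree_comp_le.trans ?_
      simpa using natDegree_ultra_le n β
    · exact (natDegree_C_mul_le _ _).trans (natDegree_ultra_le n β)
  · rw [coeff_sub, hc, coeff_C_mul, sub_self]

/-! ### The coefficients G_j of B^γ, where B = 1 + 2xw + (x²-1)w² -/

/-- The coefficients in the expansion `(1 + 2xw + (x² - 1)w²)^γ = ∑ j, G_j(x) w^j`,
with index shifted by `3` so that the first three terms vanish. -/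
noncomputable def genCoeff (γ : ℝ) : ℕ → ℝ[X]
  | 0 => 0
  | 1 => 0
  | 2 => 0
  | j + 3 => C (2 ^ j) * ultra j (γ - j)

/-- For F = B^γ this is F_x = 2γwF - w²F_w. -/
theorem derivative_genCoeff (γ : ℝ) (k : ℕ) :
    derivative (genCoeff γ (k + 1)) = C (2 * γ - k + 3) * genCoeff γ k := by
  rcases k with _ | _ | _ | j
  · simp [genCoeff]
  · simp [genCoeff]
  · simp [genCoeff, ultra_zero]
  · simp only [genCoeff]
    rw [derivative_C_mul, derivative_ultra_succ, ← mul_assoc, ← mul_assoc, ← C_mul, ← C_mul]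
    push_cast
    rw [show γ - (j + 1) + 1 = γ - j by ring,
      show (2 : ℝ) ^ (j + 1) * ((j + 2 * (γ - (j + 1)) + 2) / 2)
        = (2 * γ - (j + 1 + 1 + 1) + 3) * 2 ^ j by ring]

theorem eval_one_genCoeff (γ : ℝ) (j : ℕ) :
    (genCoeff γ (j + 3)).eval 1 = 2 ^ j * poch (γ - j + 1) j / (j.factorial : ℝ) := by
  simp only [genCoeff, eval_mul, eval_C, eval_one_ultra, mul_div_assoc]

/-- This is B·∂_w(B^γ) = γ·B_w·B^γ, read off coefficientwise. -/
theorem genCoeff_rec (γ : ℝ) (k : ℕ) :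
    C (k : ℝ) * genCoeff γ (k + 3) = C (2 * (γ - k + 1)) * X * genCoeff γ (k + 2)
      + (X ^ 2 - 1) * C (2 * γ - k + 2) * genCoeff γ (k + 1) := by
  induction k with
  | zero => simp [genCoeff]
  | succ k ih =>
    rw [← sub_eq_zero]
    apply eq_zero_of_derivative_eq_zero_of_eval_one
    · simp only [derivative_add, derivative_sub, derivative_mul, derivative_C, derivative_X,
        derivative_one, derivative_X_pow, derivative_genCoeff, zero_mul, zero_add]
      rw [← sub_eq_zero] at ih
      have h := congrArg (fun p => C (2 * γ - k + 1) * p) ih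
      simp only [mul_zero] at h
      refine Eq.trans ?_ h
      push_cast
      simp only [C_mul, C_add, C_sub, C_1, map_ofNat, pow_one, map_natCast]
      ring
    · simp only [show k + 1 + 2 = k + 3 by omega,
        eval_sub, eval_add, eval_mul, eval_C, eval_X, eval_pow, eval_one, eval_one_genCoeff,
        poch_succ_left, Nat.factorial_succ]
      have h1 : (k.factorial : ℝ) ≠ 0 := by positivity
      push_cast
      rw [show γ - (k + 1) + 1 + 1 = γ - k + 1 by ring]
      field_simp
      ring

/-- Coefficients of B^(γ+1) = B·B^γ. -/
theorem genCoeff_add_one (γ : ℝ) (k : ℕ) :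
    genCoeff (γ + 1) (k + 2) = genCoeff γ (k + 2) + C 2 * X * genCoeff γ (k + 1)
      + (X ^ 2 - 1) * genCoeff γ k := by
  induction k with
  | zero => simp [genCoeff]
  | succ k ih =>
    rw [← sub_eq_zero]
    apply eq_zero_of_derivative_eq_zero_of_eval_one
    · rcases k with _ | k
      · simp [genCoeff, ultra_zero]
      simp only [show k + 1 + 1 + 2 = k + 1 + 2 + 1 by omega]
      simp only [derivative_add, derivative_sub, derivative_mul, derivative_C, derivative_X,
        derivative_one, derivative_X_pow, derivative_genCoeff, zero_mul, zero_add]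
      rw [← sub_eq_zero] at ih
      have h := congrArg (fun p => C (2 * γ - (k + 1) + 3) * p) ih
      simp only [mul_zero] at h
      refine Eq.trans ?_ h
      push_cast
      simp only [C_mul, C_add, C_sub, C_1, map_ofNat, pow_one, map_natCast]
      ring
    · rcases k with _ | k
      · simp [genCoeff, ultra_zero]
      simp only [show k + 1 + 1 + 2 = k + 1 + 3 by omega, show k + 1 + 1 + 1 = k + 3 by omega,
        eval_sub, eval_add, eval_mul, eval_C, eval_X, eval_pow, eval_one, eval_one_genCoeff]
      have h1 : (k.factorial : ℝ) ≠ 0 := by positivity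
      rw [poch_succ_left (γ - _ + 1), poch_succ_right]
      simp only [Nat.factorial_succ]
      push_cast
      rw [show γ + 1 - (k + 1) + 1 = γ - k + 1 by ring,
        show γ - (k + 1) + 1 + 1 = γ - k + 1 by ring]
      field_simp
      ring

theorem natDegree_genCoeff_le (γ : ℝ) (j : ℕ) : (genCoeff γ (j + 3)).natDegree ≤ j :=
  (natDegree_C_mul_le _ _).trans (natDegree_ultra_le _ _)

/-- Since B = (1+xw)² - w², the top-degree part of B^γ is (1+xw)^(2γ). -/
theorem coeff_genCoeff (γ : ℝ) (j : ℕ) :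
    (genCoeff γ (j + 3)).coeff j = Ring.choose (2 * γ) j := by
  rw [choose_eq_poch]
  induction j with
  | zero => simp [genCoeff, ultra_zero]
  | succ j ih =>
    have h := congrArg (fun p => coeff p j) (derivative_genCoeff γ (j + 3))
    simp only [coeff_derivative, coeff_C_mul] at h
    rw [ih] at h
    rw [show j + 1 + 3 = j + 3 + 1 by omega, poch_succ_left, Nat.factorial_succ]
    have h1 : (j.factorial : ℝ) ≠ 0 := by positivity
    have h2 : (j : ℝ) + 1 ≠ 0 := by positivity
    push_cast at h ⊢
    rw [show 2 * γ - (j + 1) + 1 + 1 = 2 * γ - j + 1 by ring]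
    rw [eq_div_iff (by positivity)]
    rw [show 2 * γ - (j + 1) + 1 = 2 * γ - j by ring]
    rw [mul_div_assoc'] at h
    rw [eq_div_iff h1] at h
    linear_combination h

/-! ### Taylor coefficients and the sums ∑ G_j y⁽ʲ⁺ˢ⁾/(j+s)! -/

/-- The Taylor coefficients `y^{(k)} / k!` of `y` at a varying point. -/
noncomputable def taylorPoly (y : ℝ[X]) (k : ℕ) : ℝ[X] :=
  C (1 / (k.factorial : ℝ)) * derivative^[k] y

theorem derivative_taylorPoly (y : ℝ[X]) (k : ℕ) :
    derivative (taylorPoly y k) = C ((k : ℝ) + 1) * taylorPoly y (k + 1) := by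
  rw [taylorPoly, taylorPoly, derivative_C_mul, ← mul_assoc, ← C_mul,
    ← Function.iterate_succ_apply' derivative, Nat.factorial_succ]
  congr 2
  push_cast
  field_simp

theorem taylorPoly_eq_zero {y : ℝ[X]} {k : ℕ} (h : y.natDegree < k) : taylorPoly y k = 0 := by
  rw [taylorPoly, iterate_derivative_eq_zero h, mul_zero]

theorem sum_range_shift {M : Type*} [AddCommGroup M] {f : ℕ → M} {N : ℕ} (h0 : f 0 = 0)
    (hN : f N = 0) : ∑ j ∈ Finset.range N, f (j + 1) = ∑ j ∈ Finset.range N, f j := by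
  have h1 := Finset.sum_range_succ f N
  rw [Finset.sum_range_succ', h0, hN, add_zero, add_zero] at h1
  exact h1

/-- `∑ j < N, G_j y^{(j+s)} / (j+s)!`, where `G_j` are the coefficients of
`(1 + 2xw + (x² - 1)w²)^γ`. -/
noncomputable def genSum (γ : ℝ) (N s : ℕ) (y : ℝ[X]) : ℝ[X] :=
  ∑ j ∈ Finset.range N, genCoeff γ (j + 3) * taylorPoly y (j + s)

/-- Collecting G_j: differentiating G_{j+1} contributes 2γ-j, differentiating the Taylor coefficient
contributes j+s+1, and j cancels. The degree bound removes the boundary term. -/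
theorem derivative_genSum (γ : ℝ) {N : ℕ} (s : ℕ) {y : ℝ[X]} (hN : y.natDegree < N) :
    derivative (genSum γ N s y) = C (2 * γ + 1 + s) * genSum γ N (s + 1) y := by
  simp only [genSum, derivative_sum, derivative_mul, derivative_genCoeff, derivative_taylorPoly]
  rw [Finset.sum_add_distrib, Finset.mul_sum]
  have h := sum_range_shift
    (f := fun j => C (2 * γ - j + 1) * genCoeff γ (j + 2) * taylorPoly y (j + s)) (N := N)
    (by simp [genCoeff]) (by rw [taylorPoly_eq_zero (by omega), mul_zero])
  have h2 : ∑ j ∈ Finset.range N,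
      C (2 * γ - ((j + 2 : ℕ) : ℝ) + 3) * genCoeff γ (j + 2) * taylorPoly y (j + s)
      = ∑ j ∈ Finset.range N,
        C (2 * γ - j + 1) * genCoeff γ (j + 2) * taylorPoly y (j + s) :=
    Finset.sum_congr rfl fun j _ => by
      congr 3
      push_cast
      ring
  rw [h2, ← h, ← Finset.sum_add_distrib]
  refine Finset.sum_congr rfl fun j _ => ?_
  rw [show j + 1 + 2 = j + 3 by omega, show j + 1 + s = j + s + 1 by omega,
    show j + (s + 1) = j + s + 1 by omega]
  push_cast
  simp only [C_mul, C_add, C_sub, C_1, map_ofNat, map_natCast]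
  ring

theorem coeff_taylorPoly (y : ℝ[X]) (k i : ℕ) :
    (taylorPoly y k).coeff i = (i + k).choose k * y.coeff (i + k) := by
  rw [taylorPoly, coeff_C_mul, coeff_iterate_derivative, nsmul_eq_mul,
    Nat.descFactorial_eq_factorial_mul_choose]
  have h1 : (k.factorial : ℝ) ≠ 0 := by positivity
  push_cast
  field_simp

theorem natDegree_taylorPoly_le (y : ℝ[X]) (k : ℕ) :
    (taylorPoly y k).natDegree ≤ y.natDegree - k :=
  (natDegree_C_mul_le _ _).trans (natDegree_iterate_derivative _ _)

theorem eval_taylorPoly (y : ℝ[X]) (k : ℕ) (x : ℝ) :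
    (derivative^[k] y).eval x = k.factorial * (taylorPoly y k).eval x := by
  have h1 : (k.factorial : ℝ) ≠ 0 := by positivity
  rw [taylorPoly, eval_mul, eval_C]
  field_simp

theorem taylorPoly_ultra_rec (n : ℕ) (β x : ℝ) (k : ℕ) :
    (1 - x ^ 2) * ((k + 2) * (k + 1)) * (taylorPoly (ultra n β) (k + 2)).eval x
      - 2 * x * ((k + 1) * (k + β + 1)) * (taylorPoly (ultra n β) (k + 1)).eval x
      + (n * (n + 2 * β + 1) - k * (k + 2 * β + 1)) * (taylorPoly (ultra n β) k).eval x = 0 := by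
  have h := congrArg (eval x) (ultra_ode_iterate n β k)
  simp only [eval_add, eval_sub, eval_mul, eval_C, eval_X, eval_pow, eval_one, eval_zero,
    eval_taylorPoly, Nat.factorial_succ] at h
  have h1 : (k.factorial : ℝ) ≠ 0 := by positivity
  push_cast at h
  apply mul_left_cancel₀ h1
  linear_combination h

theorem sum_range_shift_two {M : Type*} [AddCommGroup M] {f : ℕ → M} {N : ℕ} (h0 : f 0 = 0)
    (h1 : f 1 = 0) (hN : f N = 0) (hN1 : f (N + 1) = 0) :
    ∑ j ∈ Finset.range N, f (j + 2) = ∑ j ∈ Finset.range N, f j := by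
  rw [← sum_range_shift h0 hN]
  exact sum_range_shift (f := fun j => f (j + 1)) h1 hN1

theorem eval_genCoeff_rec (γ x : ℝ) (k : ℕ) :
    k * (genCoeff γ (k + 3)).eval x = 2 * (γ - k + 1) * x * (genCoeff γ (k + 2)).eval x
      + (x ^ 2 - 1) * (2 * γ - k + 2) * (genCoeff γ (k + 1)).eval x := by
  have h := congrArg (eval x) (genCoeff_rec γ k)
  simpa only [eval_add, eval_sub, eval_mul, eval_C, eval_X, eval_pow, eval_one] using h

/-- After the equation for Q is applied to the Taylor coefficients and indices are shifted, what
remains is the recurrence for G_j weighted by (j+2α+5)q_{j+2}. -/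
theorem genSum_ode (n : ℕ) (α : ℝ) :
    (1 - X ^ 2) * derivative (derivative (genSum α (n + 1) 2 (ultra n α)))
      - C (2 * (α + 2 + 1)) * X * derivative (genSum α (n + 1) 2 (ultra n α))
      + C (n * (n + 2 * α + 1) - 4 * α - 6) * genSum α (n + 1) 2 (ultra n α) = 0 := by
  have hdeg : (ultra n α).natDegree < n + 1 := Nat.lt_succ_of_le (natDegree_ultra_le n α)
  rw [derivative_genSum α 2 hdeg, derivative_C_mul, derivative_genSum α (2 + 1) hdeg]
  refine Polynomial.funext fun x => ?_
  simp only [genSum, eval_add, eval_sub, eval_mul, eval_C, eval_X, eval_pow, eval_one, eval_zero,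
    eval_finsetSum, Finset.mul_sum, ← Finset.sum_add_distrib, ← Finset.sum_sub_distrib]
  set q : ℕ → ℝ := fun k => (taylorPoly (ultra n α) k).eval x with hq
  set G : ℕ → ℝ := fun k => (genCoeff α k).eval x with hG
  have hq0 (k : ℕ) (hk : n + 1 ≤ k) : q k = 0 := by
    simp only [hq]
    rw [taylorPoly_eq_zero (by omega), eval_zero]
  have s1 := sum_range_shift (N := n + 1)
    (f := fun j => G (j + 2) * (2 * x * (((j : ℝ) - 1 - α) * (j + 2 * α + 5))) * q (j + 2))
    (by simp [hG, genCoeff]) (by rw [hq0 _ (by omega), mul_zero])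
  have s2 := sum_range_shift_two (N := n + 1)
    (f := fun j => G (j + 1) * ((1 - x ^ 2) * ((2 * α - (j : ℝ) + 2) * (2 * α + 5 + j)))
      * q (j + 2))
    (by simp [hG, genCoeff]) (by simp [hG, genCoeff]) (by rw [hq0 _ (by omega), mul_zero])
    (by rw [hq0 _ (by omega), mul_zero])
  have s0 : ∑ j ∈ Finset.range (n + 1), (j * (j + 2 * α + 5) * G (j + 3) * q (j + 2)
      + G (j + 2) * (2 * x * (((j : ℝ) - 1 - α) * (j + 2 * α + 5))) * q (j + 2)
      + G (j + 1) * ((1 - x ^ 2) * ((2 * α - (j : ℝ) + 2) * (2 * α + 5 + j))) * q (j + 2)) = 0 := by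
    refine Finset.sum_eq_zero fun j _ => ?_
    have h := eval_genCoeff_rec α x j
    linear_combination (j + 2 * α + 5) * q (j + 2) * h
  rw [Finset.sum_add_distrib, Finset.sum_add_distrib, ← s1, ← s2, ← Finset.sum_add_distrib,
    ← Finset.sum_add_distrib] at s0
  rw [← s0]
  refine Finset.sum_congr rfl fun j _ => ?_
  have h := taylorPoly_ultra_rec n α x (j + 2)
  change _ * q (j + 4) - _ * q (j + 3) + _ * q (j + 2) = 0 at h
  change _ * (_ * (_ * (G (j + 3) * q (j + 4)))) - _ * (_ * (G (j + 3) * q (j + 3)))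
    + _ * (G (j + 3) * q (j + 2)) = _ * G (j + 3) * q (j + 2)
      + G (j + 3) * _ * q (j + 3) + G (j + 3) * _ * q (j + 4)
  push_cast at h ⊢
  linear_combination G (j + 3) * h

theorem natDegree_genSum_le (γ : ℝ) (N m : ℕ) {y : ℝ[X]} (hy : y.natDegree ≤ m + 2) :
    (genSum γ N 2 y).natDegree ≤ m := by
  refine natDegree_sum_le_of_forall_le _ _ fun j _ => ?_
  by_cases hj : j ≤ m
  · refine natDegree_mul_le.trans ?_
    have h1 := natDegree_genCoeff_le γ j
    have h2 := natDegree_taylorPoly_le y (j + 2)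
    omega
  · rw [taylorPoly_eq_zero (by omega), mul_zero, natDegree_zero]
    exact Nat.zero_le _

/-- Products of top coefficients, C(2γ, j)·C(m+2, m-j), sum by Vandermonde. -/
theorem coeff_genSum (γ : ℝ) (m : ℕ) {y : ℝ[X]} (hy : y.natDegree ≤ m + 2) :
    (genSum γ (m + 3) 2 y).coeff m = Ring.choose (2 * γ + (m + 2 : ℕ)) m * y.coeff (m + 2) := by
  rw [genSum, Finset.sum_range_succ, Finset.sum_range_succ, taylorPoly_eq_zero (k := m + 1 + 2)
    (by omega), taylorPoly_eq_zero (k := m + 2 + 2) (by omega), mul_zero, mul_zero, add_zero,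
    add_zero, finsetSum_coeff, Ring.add_choose_eq m (Commute.all _ _),
    Finset.Nat.sum_antidiagonal_eq_sum_range_succ_mk, Finset.sum_mul]
  refine Finset.sum_congr rfl fun j hj => ?_
  have hj : j ≤ m := by simpa [Nat.lt_succ_iff] using hj
  obtain ⟨i, rfl⟩ := Nat.exists_eq_add_of_le hj
  rw [coeff_mul_add_eq_of_natDegree_le (natDegree_genCoeff_le γ j)
    ((natDegree_taylorPoly_le y (j + 2)).trans (by omega)), coeff_genCoeff, coeff_taylorPoly,
    Ring.choose_natCast, show i + (j + 2) = j + i + 2 by omega, show j + i - j = i by omega,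
    Nat.choose_symm_of_eq_add (show j + i + 2 = (j + 2) + i by omega), mul_assoc]

theorem genSum_ultra {α : ℝ} (hα : -1 < α) (n : ℕ) :
    genSum α (n + 1) 2 (ultra n α)
      = C (dividedBinom α n / (2 * (α + 1))) * derivative^[2] (ultra n α) := by
  have hdeg := natDegree_ultra_le n α
  by_cases hn : n < 2
  · rw [iterate_derivative_eq_zero (by omega), mul_zero, genSum]
    exact Finset.sum_eq_zero fun j _ => by rw [taylorPoly_eq_zero (by omega), mul_zero]
  obtain ⟨m, rfl⟩ := Nat.exists_eq_add_of_le' (not_lt.mp hn)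
  rw [← sub_eq_zero]
  refine eq_zero_of_ode (β := α + 2) (m := m) (by linarith) ?_ ?_ ?_
  · have h1 := genSum_ode (m + 2) α
    have h2 := ultra_ode_iterate (m + 2) α 2
    set W := genSum α (m + 2 + 1) 2 (ultra (m + 2) α)
    rw [derivative_sub, derivative_sub, derivative_C_mul, derivative_C_mul,
      ← Function.iterate_succ_apply' derivative, ← Function.iterate_succ_apply' derivative]
    have e1 : (((m + 2 : ℕ) : ℝ) * ((m + 2 : ℕ) + 2 * α + 1) - 4 * α - 6)
        = m * (m + 2 * (α + 2) + 1) := by push_cast; ring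
    have e2 : (((m + 2 : ℕ) : ℝ) * ((m + 2 : ℕ) + 2 * α + 1)
        - (2 : ℕ) * ((2 : ℕ) + 2 * α + 1)) = m * (m + 2 * (α + 2) + 1) := by push_cast; ring
    rw [e1] at h1
    rw [e2] at h2
    push_cast at h2
    linear_combination h1 - C (dividedBinom α (m + 2) / (2 * (α + 1))) * h2
  · refine (natDegree_sub_le _ _).trans (max_le (natDegree_genSum_le _ _ _ hdeg) ?_)
    refine (natDegree_C_mul_le _ _).trans ((natDegree_iterate_derivative _ _).trans ?_)
    omega
  · rw [coeff_sub, coeff_genSum α m hdeg, coeff_C_mul, coeff_iterate_derivative, choose_eq_poch]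
    have h1 : (m.factorial : ℝ) ≠ 0 := by positivity
    have h2 : α + 1 ≠ 0 := by linarith
    simp only [dividedBinom, Nat.factorial_succ, nsmul_eq_mul, poch_succ_left, Nat.descFactorial]
    push_cast
    rw [show 2 * α + ((m : ℝ) + 2) - m + 1 = 2 * α + 2 + 1 by ring]
    field_simp
    ring

/-! ### Passing from exponent γ to γ + 1 -/

theorem eval_genCoeff_add_one (γ x : ℝ) (k : ℕ) :
    (genCoeff (γ + 1) (k + 2)).eval x = (genCoeff γ (k + 2)).eval x
      + 2 * x * (genCoeff γ (k + 1)).eval x + (x ^ 2 - 1) * (genCoeff γ k).eval x := by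
  have h := congrArg (eval x) (genCoeff_add_one γ k)
  simpa only [eval_add, eval_sub, eval_mul, eval_C, eval_X, eval_pow, eval_one] using h

theorem sum_range_shift_three {M : Type*} [AddCommGroup M] {f : ℕ → M} {N : ℕ} (h0 : f 0 = 0)
    (h1 : f 1 = 0) (h2 : f 2 = 0) (hN : f N = 0) (hN1 : f (N + 1) = 0) (hN2 : f (N + 2) = 0) :
    ∑ j ∈ Finset.range N, f (j + 3) = ∑ j ∈ Finset.range N, f j := by
  rw [← sum_range_shift h0 hN]
  exact sum_range_shift_two (f := fun j => f (j + 1)) h1 h2 hN1 hN2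

theorem eval_genSum (γ x : ℝ) (N s : ℕ) (y : ℝ[X]) :
    (genSum γ N s y).eval x
      = ∑ j ∈ Finset.range N, (genCoeff γ (j + 3)).eval x * (taylorPoly y (j + s)).eval x := by
  simp only [genSum, eval_finsetSum, eval_mul]

theorem eval_genSum_add_one (γ x : ℝ) {N : ℕ} {y : ℝ[X]} (hN : y.natDegree < N) :
    (genSum (γ + 1) N 2 y).eval x = (genSum γ N 2 y).eval x + 2 * x * (genSum γ N 3 y).eval x
      + (x ^ 2 - 1) * (genSum γ N 4 y).eval x := by
  simp only [eval_genSum]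
  set q : ℕ → ℝ := fun k => (taylorPoly y k).eval x with hq
  set G : ℕ → ℝ := fun k => (genCoeff γ k).eval x with hG
  have hq0 (k : ℕ) (hk : N ≤ k) : q k = 0 := by
    simp only [hq]
    rw [taylorPoly_eq_zero (by omega), eval_zero]
  have s1 := sum_range_shift (N := N) (f := fun j => G (j + 2) * q (j + 2))
    (by simp [hG, genCoeff]) (by rw [hq0 _ (by omega), mul_zero])
  have s2 := sum_range_shift_two (N := N) (f := fun j => G (j + 1) * q (j + 2))
    (by simp [hG, genCoeff]) (by simp [hG, genCoeff]) (by rw [hq0 _ (by omega), mul_zero])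
    (by rw [hq0 _ (by omega), mul_zero])
  change _ = _ + _ * ∑ j ∈ Finset.range N, G (j + 3) * q (j + 3)
    + _ * ∑ j ∈ Finset.range N, G (j + 3) * q (j + 4)
  rw [s1, s2, Finset.mul_sum, Finset.mul_sum, ← Finset.sum_add_distrib, ← Finset.sum_add_distrib]
  refine Finset.sum_congr rfl fun j _ => ?_
  rw [eval_genCoeff_add_one]
  ring

theorem taylorPoly_X_mul_derivative (y : ℝ[X]) (k : ℕ) :
    taylorPoly (X * derivative y) k
      = C ((k : ℝ) + 1) * X * taylorPoly y (k + 1) + C (k : ℝ) * taylorPoly y k := by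
  induction k with
  | zero => simp [taylorPoly]
  | succ k ih =>
    have h1 : C ((k : ℝ) + 1) ≠ 0 := by
      rw [Ne, C_eq_zero]
      positivity
    apply mul_left_cancel₀ h1
    rw [← derivative_taylorPoly, ih]
    simp only [derivative_add, derivative_mul, derivative_C, derivative_X, derivative_taylorPoly]
    push_cast
    simp only [C_add, C_1]
    ring

/-- The Taylor coefficients of xy' bring in factors of j; two consecutive instances of the
recurrence for G_j (`r1`, `r2`) remove them. -/
theorem eval_genSum_X_mul_derivative (γ x : ℝ) {N : ℕ} {y : ℝ[X]} (hN : y.natDegree < N) :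
    (genSum (γ + 1) N 2 (X * derivative y)).eval x
      = 2 * (genSum γ N 2 y).eval x + (2 * γ + 9) * x * (genSum γ N 3 y).eval x
        + ((4 * γ + 12) * x ^ 2 - 2 * γ - 4) * (genSum γ N 4 y).eval x
        + (2 * γ + 5) * x * (x ^ 2 - 1) * (genSum γ N 5 y).eval x := by
  simp only [eval_genSum, taylorPoly_X_mul_derivative, eval_add, eval_mul, eval_C, eval_X]
  set q : ℕ → ℝ := fun k => (taylorPoly y k).eval x with hq
  set G : ℕ → ℝ := fun k => (genCoeff γ k).eval x with hG
  set H : ℕ → ℝ := fun k => (genCoeff (γ + 1) k).eval x with hH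
  have hq0 (k : ℕ) (hk : N ≤ k) : q k = 0 := by
    simp only [hq]
    rw [taylorPoly_eq_zero (by omega), eval_zero]
  have sl := sum_range_shift (N := N)
    (f := fun j => H (j + 2) * (((j : ℝ) + 2) * x * q (j + 2)))
    (by simp [hH, genCoeff]) (by rw [hq0 _ (by omega), mul_zero, mul_zero])
  have s1 := sum_range_shift (N := N) (f := fun j => G (j + 2) * q (j + 2))
    (by simp [hG, genCoeff]) (by rw [hq0 _ (by omega), mul_zero])
  have s2 := sum_range_shift_two (N := N) (f := fun j => G (j + 1) * q (j + 2))
    (by simp [hG, genCoeff]) (by simp [hG, genCoeff]) (by rw [hq0 _ (by omega), mul_zero])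
    (by rw [hq0 _ (by omega), mul_zero])
  have s3 := sum_range_shift_three (N := N) (f := fun j => G j * q (j + 2))
    (by simp [hG, genCoeff]) (by simp [hG, genCoeff]) (by simp [hG, genCoeff])
    (by rw [hq0 _ (by omega), mul_zero])
    (by rw [hq0 _ (by omega), mul_zero]) (by rw [hq0 _ (by omega), mul_zero])
  change _ = _ + _ * ∑ j ∈ Finset.range N, G (j + 3) * q (j + 3)
    + _ * ∑ j ∈ Finset.range N, G (j + 3) * q (j + 4)
    + _ * ∑ j ∈ Finset.range N, G (j + 3) * q (j + 5)
  rw [s1, s2, s3]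
  have hl : ∑ j ∈ Finset.range N, H (j + 3) *
      ((((j + 2 : ℕ) : ℝ) + 1) * x * q (j + 2 + 1) + ((j + 2 : ℕ) : ℝ) * q (j + 2))
      = ∑ j ∈ Finset.range N, H (j + 3) * (((j : ℝ) + 2) * q (j + 2))
        + ∑ j ∈ Finset.range N, H (j + 1 + 2) * (((j + 1 : ℕ) + (2 : ℝ)) * x * q (j + 1 + 2)) := by
    rw [← Finset.sum_add_distrib]
    refine Finset.sum_congr rfl fun j _ => ?_
    rw [show j + 1 + 2 = j + 2 + 1 by omega, show j + 2 + 1 = j + 3 by omega]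
    push_cast
    ring
  change ∑ j ∈ Finset.range N, H (j + 3) *
      ((((j + 2 : ℕ) : ℝ) + 1) * x * q (j + 2 + 1) + ((j + 2 : ℕ) : ℝ) * q (j + 2)) = _
  rw [hl, sl]
  simp only [Finset.mul_sum, ← Finset.sum_add_distrib]
  refine Finset.sum_congr rfl fun j _ => ?_
  have e1 : H (j + 3) = _ := eval_genCoeff_add_one γ x (j + 1)
  have e2 : H (j + 2) = _ := eval_genCoeff_add_one γ x j
  rw [e1, e2]
  have r1 := eval_genCoeff_rec γ x j
  change _ * G (j + 3) = _ * G (j + 2) + _ * G (j + 1) at r1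
  have r2 : ((j : ℝ) - 1) * G (j + 2) = 2 * (γ - j + 2) * x * G (j + 1)
      + (x ^ 2 - 1) * (2 * γ - j + 3) * G j := by
    rcases j with _ | j
    · simp [hG, genCoeff]
    · have h := eval_genCoeff_rec γ x j
      change _ * G (j + 1 + 2) = _ * G (j + 1 + 1) + _ * G (j + 1) at h
      push_cast
      linear_combination h
  change (G (j + 3) + _ * G (j + 2) + _ * G (j + 1)) * _
    + (G (j + 2) + _ * G (j + 1) + _ * G j) * _ = _
  linear_combination q (j + 2) * r1 + x * q (j + 2) * r2

/-! ### The c-part applied to Q and to xQ' -/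

/-- Exhibits the factor λ(λ-2α-2), which the differential equation converts into derivatives of Q.
-/
theorem c₀_eq {α : ℝ} (hα : -1 < α) (n : ℕ) :
    c₀ α n = 2 * (dividedBinom α n / (2 * (α + 1))) * (n * (n + 2 * α + 1))
      * (n * (n + 2 * α + 1) - 2 * α - 2) / (α + 2) := by
  rcases n with _ | _ | m
  · simp [c₀, binom]
  · simp [c₀, binom]
    rw [show (1 : ℝ) + 2 * α + 1 - 2 * α - 2 = 0 by ring]
    simp
  · have h1 : (m.factorial : ℝ) ≠ 0 := by positivity
    have h2 : α + 1 ≠ 0 := by linarith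
    have h3 : α + 2 ≠ 0 := by linarith
    have h4 : 2 * α + 2 ≠ 0 := by linarith
    have h5 : 2 * α + 4 ≠ 0 := by linarith
    have e : poch (2 * α + 2) (m + 1) * (2 * α + 2 + (m + 1 : ℕ)) * (2 * α + 2 + (m + 2 : ℕ))
        = (2 * α + 2) * ((2 * α + 3) * ((2 * α + 4) * poch (2 * α + 5) m)) := by
      rw [← poch_succ_right, ← poch_succ_right, poch_succ_left, poch_succ_left, poch_succ_left]
      ring_nf
    rw [c₀, show ((m + 1 + 1 : ℕ) : ℤ) - 2 = (m : ℤ) by push_cast; ring, binom_natCast]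
    simp only [dividedBinom, Nat.factorial_succ]
    push_cast at e ⊢
    rw [show (m : ℝ) + 1 + 1 + 2 * α + 2 - m + 1 = 2 * α + 5 by ring]
    generalize poch (2 * α + 2) (m + 1) = u at e ⊢
    generalize poch (2 * α + 5) m = v at e ⊢
    field_simp
    linear_combination (-(m : ℝ) - 1) * e

theorem genSum_ultra_succ {α : ℝ} (hα : -1 < α) (n : ℕ) (x : ℝ) :
    (2 * α + 3) * (genSum α (n + 1) 3 (ultra n α)).eval x
      = dividedBinom α n / (2 * (α + 1)) * (derivative^[3] (ultra n α)).eval x ∧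
    (2 * α + 3) * (2 * α + 4) * (genSum α (n + 1) 4 (ultra n α)).eval x
      = dividedBinom α n / (2 * (α + 1)) * (derivative^[4] (ultra n α)).eval x ∧
    (2 * α + 3) * (2 * α + 4) * (2 * α + 5) * (genSum α (n + 1) 5 (ultra n α)).eval x
      = dividedBinom α n / (2 * (α + 1)) * (derivative^[5] (ultra n α)).eval x := by
  have hdeg : (ultra n α).natDegree < n + 1 := Nat.lt_succ_of_le (natDegree_ultra_le n α)
  have h2 := genSum_ultra hα n
  have h3 := congrArg derivative h2
  rw [derivative_genSum α 2 hdeg, derivative_C_mul,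
    ← Function.iterate_succ_apply' derivative] at h3
  have h4 := congrArg derivative h3
  rw [derivative_C_mul, derivative_genSum α (2 + 1) hdeg, derivative_C_mul,
    ← Function.iterate_succ_apply' derivative] at h4
  have h5 := congrArg derivative h4
  rw [derivative_C_mul, derivative_C_mul, derivative_genSum α (2 + 1 + 1) hdeg, derivative_C_mul,
    ← Function.iterate_succ_apply' derivative] at h5
  replace h3 := congrArg (eval x) h3
  replace h4 := congrArg (eval x) h4
  replace h5 := congrArg (eval x) h5
  simp only [eval_mul, eval_C] at h3 h4 h5
  push_cast at h3 h4 h5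
  exact ⟨by linear_combination h3, by linear_combination h4, by linear_combination h5⟩

theorem eval_ode_iterate (n : ℕ) (α x : ℝ) (k : ℕ) :
    (1 - x ^ 2) * (derivative^[k + 2] (ultra n α)).eval x
      - 2 * (α + k + 1) * x * (derivative^[k + 1] (ultra n α)).eval x
      + (n * (n + 2 * α + 1) - k * (k + 2 * α + 1)) * (derivative^[k] (ultra n α)).eval x = 0 := by
  have h := congrArg (eval x) (ultra_ode_iterate n α k)
  simpa only [eval_add, eval_sub, eval_mul, eval_C, eval_X, eval_pow, eval_one, eval_zero] using h

theorem c₀_add_genSum_ultra {α : ℝ} (hα : -1 < α) (n : ℕ) (x : ℝ) :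
    c₀ α n * (ultra n α).eval x
      + 4 * (2 * α + 3) * (1 - x ^ 2) * (genSum (α + 1) (n + 1) 2 (ultra n α)).eval x
      = 4 * dividedBinom α n * (derivative^[2] (ultra n α)).eval x := by
  have hdeg : (ultra n α).natDegree < n + 1 := Nat.lt_succ_of_le (natDegree_ultra_le n α)
  obtain ⟨h3, h4, -⟩ := genSum_ultra_succ hα n x
  have h2 := congrArg (eval x) (genSum_ultra hα n)
  rw [eval_mul, eval_C] at h2
  rw [eval_genSum_add_one α x hdeg, c₀_eq hα]
  have hr : dividedBinom α n = 2 * (α + 1) * (dividedBinom α n / (2 * (α + 1))) := by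
    have : α + 1 ≠ 0 := by linarith
    field_simp
  set κ := dividedBinom α n / (2 * (α + 1))
  rw [hr]
  have o0 := eval_ode_iterate n α x 0
  have o1 := eval_ode_iterate n α x 1
  have o2 := eval_ode_iterate n α x 2
  push_cast at o0 o1 o2
  simp only [zero_add, Function.iterate_zero, id] at o0 o1 o2
  have hα2 : α + 2 ≠ 0 := by linarith
  set l : ℝ := n * (n + 2 * α + 1)
  -- The equations for Q, Q' and Q'' together eliminate λ from the right-hand side.
  have hQ : l * (l - 2 * α - 2) * (ultra n α).eval x
      = (4 * (α + 1) * (α + 2) * x ^ 2 - (1 - x ^ 2) * (2 * α + 4))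
          * (derivative^[2] (ultra n α)).eval x
        - (1 - x ^ 2) * (4 * α + 8) * x * (derivative^[3] (ultra n α)).eval x
        + (1 - x ^ 2) ^ 2 * (derivative^[4] (ultra n α)).eval x := by
    linear_combination (l - 2 * α - 2) * o0 + 2 * (α + 1) * x * o1 - (1 - x ^ 2) * o2
  field_simp
  linear_combination 2 * κ * hQ + (α + 2) * 4 * (2 * α + 3) * (1 - x ^ 2) * h2
    + (α + 2) * 8 * (1 - x ^ 2) * x * h3 - 2 * (1 - x ^ 2) ^ 2 * h4

theorem c₀_add_genSum_X_mul_derivative {α : ℝ} (hα : -1 < α) (n : ℕ) (x : ℝ) :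
    c₀ α n * (X * derivative (ultra n α)).eval x
      + 4 * (2 * α + 3) * (1 - x ^ 2)
        * (genSum (α + 1) (n + 1) 2 (X * derivative (ultra n α))).eval x
      = 2 * (dividedBinom α n * (n * (n + 2 * α + 1)) / (α + 1))
        * (derivative^[2] (ultra n α)).eval x := by
  have hdeg : (ultra n α).natDegree < n + 1 := Nat.lt_succ_of_le (natDegree_ultra_le n α)
  obtain ⟨h3, h4, h5⟩ := genSum_ultra_succ hα n x
  have h2 := congrArg (eval x) (genSum_ultra hα n)
  rw [eval_mul, eval_C] at h2
  rw [eval_genSum_X_mul_derivative α x hdeg, c₀_eq hα, eval_mul, eval_X]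
  have hα1 : α + 1 ≠ 0 := by linarith
  have hα2 : α + 2 ≠ 0 := by linarith
  have hr : dividedBinom α n = 2 * (α + 1) * (dividedBinom α n / (2 * (α + 1))) := by
    field_simp
  set κ := dividedBinom α n / (2 * (α + 1))
  rw [hr]
  have o1 := eval_ode_iterate n α x 1
  have o2 := eval_ode_iterate n α x 2
  have o3 := eval_ode_iterate n α x 3
  push_cast at o1 o2 o3
  simp only [Function.iterate_one] at o1 o2 o3
  set l : ℝ := n * (n + 2 * α + 1)
  field_simp
  linear_combination 2 * κ * x * l * o1
    - 2 * κ * (1 - x ^ 2) * (2 * (α + 2) * o2 + x * o3)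
    + (α + 2) * 8 * (2 * α + 3) * (1 - x ^ 2) * h2
    + (α + 2) * 4 * (2 * α + 9) * (1 - x ^ 2) * x * h3
    + 2 * (1 - x ^ 2) * ((4 * α + 12) * x ^ 2 - 2 * α - 4) * h4
    - 2 * (1 - x ^ 2) ^ 2 * x * h5

/-! ### The operator a₀ + ∑ aᵢDⁱ and its b- and c-parts -/

/-- The operator `y ↦ a₀ y + ∑_{i ≥ 1} a_i y^{(i)}` evaluated at `x`. -/
noncomputable def diffOp (a₀ : ℝ) (a : ℕ → ℝ → ℝ) (y : ℝ[X]) (x : ℝ) : ℝ :=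
  a₀ * y.eval x + ∑' i : ℕ, a (i + 1) x * (derivative^[i + 1] y).eval x

theorem diffOp_eq_sum (a₀ : ℝ) (a : ℕ → ℝ → ℝ) {y : ℝ[X]} {N : ℕ} (hN : y.natDegree ≤ N) (x : ℝ) :
    diffOp a₀ a y x = a₀ * y.eval x
      + ∑ i ∈ Finset.range N, a (i + 1) x * (derivative^[i + 1] y).eval x := by
  rw [diffOp, tsum_eq_sum fun i hi => ?_]
  have hi : N ≤ i := by simpa using hi
  rw [iterate_derivative_eq_zero (by omega), eval_zero, mul_zero]

theorem diffOp_sub (a₀ : ℝ) (a : ℕ → ℝ → ℝ) (y z : ℝ[X]) (x : ℝ) :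
    diffOp a₀ a (y - z) x = diffOp a₀ a y x - diffOp a₀ a z x := by
  simp only [diffOp, iterate_derivative_sub, eval_sub, mul_sub]
  rw [(summable_series a y x).tsum_sub (summable_series a z x)]
  ring

theorem diffOp_C_mul (a₀ : ℝ) (a : ℕ → ℝ → ℝ) (r : ℝ) (y : ℝ[X]) (x : ℝ) :
    diffOp a₀ a (C r * y) x = r * diffOp a₀ a y x := by
  simp only [diffOp, iterate_derivative_C_mul, eval_mul, eval_C, mul_left_comm _ r]
  rw [tsum_mul_left]
  ring

theorem diffOp_coeff_sub (a₀ b₀ : ℝ) (a b : ℕ → ℝ → ℝ) (y : ℝ[X]) (x : ℝ) :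
    diffOp (a₀ - b₀) (fun i x => a i x - b i x) y x = diffOp a₀ a y x - diffOp b₀ b y x := by
  simp only [diffOp, sub_mul]
  rw [(summable_series a y x).tsum_sub (summable_series b y x)]
  ring

theorem diffOp_coeff_add (a₀ b₀ t : ℝ) (a b : ℕ → ℝ → ℝ) (y : ℝ[X]) (x : ℝ) :
    diffOp (t * a₀ + b₀) (fun i x => t * a i x + b i x) y x
      = t * diffOp a₀ a y x + diffOp b₀ b y x := by
  simp only [diffOp, add_mul, mul_assoc]
  rw [((summable_series a y x).mul_left t).tsum_add (summable_series b y x), tsum_mul_left]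
  ring

theorem diffOp_c (α a₀ x : ℝ) {N : ℕ} {y : ℝ[X]} (hN : y.natDegree < N) :
    diffOp a₀ (c α) y x = a₀ * y.eval x
      + 4 * (2 * α + 3) * (1 - x ^ 2) * (genSum (α + 1) N 2 y).eval x := by
  rw [diffOp_eq_sum a₀ (c α) (N := N + 1) (by omega), Finset.sum_range_succ', eval_genSum,
    Finset.mul_sum]
  simp only [c, zero_add, le_refl, if_true, zero_mul, add_zero]
  congr 1
  refine Finset.sum_congr rfl fun j _ => ?_
  rw [if_neg (by omega), show j + 1 + 1 - 2 = j by omega, show j + 1 + 1 = j + 2 by omega,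
    eval_taylorPoly]
  have h1 : ((j + 2).factorial : ℝ) ≠ 0 := by positivity
  simp only [genCoeff, eval_mul, eval_C]
  rw [show α - ((j + 2 : ℕ) : ℝ) + 3 = α + 1 - j by push_cast; ring, pow_add]
  field_simp
  ring

/-- Since bᵢ = (-2x)ⁱ/(2·i!), the series is half the Taylor expansion about x with increment -2x,
without its constant term. -/
theorem diffOp_b (a₀ x : ℝ) (y : ℝ[X]) :
    diffOp a₀ b y x = a₀ * y.eval x + (y.eval (-x) - y.eval x) / 2 := by
  have h : y.eval (-x) = ∑ i ∈ Finset.range (y.natDegree + 1),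
      (taylorPoly y i).eval x * (-2 * x) ^ i := by
    rw [show -x = -2 * x + x by ring, ← taylor_eval,
      eval_eq_sum_range' (n := y.natDegree + 1) (by rw [natDegree_taylor]; omega)]
    refine Finset.sum_congr rfl fun i _ => ?_
    rw [taylor_coeff]
    congr 1
    have h1 : (i.factorial : ℝ) ≠ 0 := by positivity
    apply mul_left_cancel₀ h1
    rw [← eval_taylorPoly, ← factorial_smul_hasseDeriv]
    simp [nsmul_eq_mul]
  rw [Finset.sum_range_succ'] at h
  simp only [pow_zero, mul_one] at h
  rw [diffOp_eq_sum a₀ b le_rfl, h]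
  have h0 : (taylorPoly y 0).eval x = y.eval x := by simp [taylorPoly]
  rw [h0, add_sub_cancel_right, Finset.sum_div]
  congr 1
  refine Finset.sum_congr rfl fun i _ => ?_
  rw [eval_taylorPoly, b, Nat.add_sub_cancel]
  have h1 : ((i + 1).factorial : ℝ) ≠ 0 := by positivity
  rw [show (-2 * x) ^ (i + 1) = 2 ^ (i + 1) * (-x) ^ (i + 1) by rw [← mul_pow]; ring,
    pow_succ (2 : ℝ) i]
  field_simp

theorem diffOp_b_eq_zero {n : ℕ} {y : ℝ[X]} (hy : y.comp (-X) = C ((-1) ^ n) * y) (x : ℝ) :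
    diffOp (b₀ n) b y x = 0 := by
  have h := congrArg (eval x) hy
  rw [eval_comp, eval_neg, eval_X, eval_mul, eval_C] at h
  rw [diffOp_b, h, b₀]
  ring

theorem X_mul_derivative_comp_neg {r : ℝ} {y : ℝ[X]} (hy : y.comp (-X) = C r * y) :
    (X * derivative y).comp (-X) = C r * (X * derivative y) := by
  have h := congrArg derivative hy
  rw [derivative_comp, derivative_C_mul] at h
  simp only [derivative_neg, derivative_X, mul_comp, X_comp] at h ⊢
  linear_combination X * h

theorem natDegree_X_mul_derivative_le (y : ℝ[X]) :
    (X * derivative y).natDegree ≤ y.natDegree := by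
  rcases Nat.eq_zero_or_pos y.natDegree with h | h
  · rw [derivative_eq_zero.mpr h, mul_zero, natDegree_zero]
    exact Nat.zero_le _
  · refine natDegree_mul_le.trans ?_
    have h1 := natDegree_derivative_le y
    rw [natDegree_X]
    omega

/-! ### Factoring C₀ and C₁, and removing M -/

/-- The factor `n binom (n + 2α + 1) n / (α + 1)` through which `C₀ = (1 + Mσ)²`. -/
noncomputable def sigma (α : ℝ) (n : ℕ) : ℝ :=
  dividedBinom α n * (n * (n + 2 * α + 1)) / (α + 1)

theorem dividedBinom_pos {α : ℝ} (hα : -1 < α) (n : ℕ) : 0 < dividedBinom α (n + 1) := by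
  rw [dividedBinom]
  exact div_pos (poch_pos (by linarith) _) (by positivity)

theorem sigma_nonneg {α : ℝ} (hα : -1 < α) (n : ℕ) : 0 ≤ sigma α n := by
  rcases n with _ | n
  · simp [sigma]
  · have h1 := dividedBinom_pos hα n
    have h2 : 0 < α + 1 := by linarith
    have h3 : (0 : ℝ) ≤ n := by positivity
    rw [sigma]
    push_cast
    have h4 : 0 ≤ (n : ℝ) + 1 + 2 * α + 1 := by linarith
    positivity

theorem binom_add_one {α : ℝ} (n : ℕ) :
    n * binom (n + 2 * α + 1) n = dividedBinom α n * (n * (n + 2 * α + 1)) := by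
  rcases n with _ | m
  · simp
  · rw [binom_natCast, dividedBinom]
    push_cast
    rw [show (m : ℝ) + 1 + 2 * α + 1 - (m + 1) + 1 = 2 * α + 2 by ring, poch_succ_right]
    ring

theorem binom_sub_one (α : ℝ) (n : ℕ) :
    binom (n + 2 * α) ((n : ℤ) - 1) = n * dividedBinom α n := by
  rcases n with _ | m
  · simp [binom]
  · rw [show ((m + 1 : ℕ) : ℤ) - 1 = (m : ℤ) by push_cast; ring, binom_natCast, dividedBinom,
      Nat.factorial_succ]
    have h1 : (m.factorial : ℝ) ≠ 0 := by positivity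
    push_cast
    rw [show (m : ℝ) + 1 + 2 * α - m + 1 = 2 * α + 2 by ring]
    field_simp

theorem binom_add_one_sub_one {α : ℝ} (hα : -1 < α) (n : ℕ) :
    2 * binom (n + 2 * α + 1) ((n : ℤ) - 1) = sigma α n := by
  rcases n with _ | m
  · simp [binom, sigma]
  · rw [show ((m + 1 : ℕ) : ℤ) - 1 = (m : ℤ) by push_cast; ring, binom_natCast, sigma,
      dividedBinom, Nat.factorial_succ]
    have h1 : (m.factorial : ℝ) ≠ 0 := by positivity
    have h2 : α + 1 ≠ 0 := by linarith
    have e := (poch_succ_right (2 * α + 2) m).symm.trans (poch_succ_left (2 * α + 2) m)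
    push_cast
    rw [show (m : ℝ) + 1 + 2 * α + 1 - m + 1 = 2 * α + 2 + 1 by ring]
    generalize poch (2 * α + 2) m = u at e ⊢
    generalize poch (2 * α + 2 + 1) m = v at e ⊢
    field_simp
    linear_combination -e

theorem C0_eq {α : ℝ} (hα : -1 < α) (n : ℕ) (M : ℝ) : C0 n α M = (1 + M * sigma α n) ^ 2 := by
  have h1 := binom_add_one (α := α) n
  have h2 := binom_add_one_sub_one hα n
  have h3 : sigma α n = n * binom (n + 2 * α + 1) n / (α + 1) := by rw [h1, sigma]
  rw [C0, show 4 * M ^ 2 * binom (n + 2 * α + 1) ((n : ℤ) - 1) ^ 2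
    = M ^ 2 * (2 * binom (n + 2 * α + 1) ((n : ℤ) - 1)) ^ 2 by ring, h2]
  linear_combination -2 * M * h3

theorem C1_eq (α : ℝ) (n : ℕ) (M : ℝ) :
    C1 n α M = 2 * M * dividedBinom α n * (1 + M * sigma α n) := by
  have h1 := binom_add_one (α := α) n
  rw [C1, binom_sub_one, sigma, ← h1]
  ring

/-- The second-order operator of (*) kills Q and, by the equation for Q', sends xQ' to 2Q''; a
factor M(1+Mσ) then splits off. -/
theorem satisfiesDE_genUltra_iff {α : ℝ} (hα : -1 < α) (M : ℝ) (a₀ : ℕ → ℝ) (a : ℕ → ℝ → ℝ)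
    (n : ℕ) :
    SatisfiesDE α M a₀ a n (genUltra n α M) ↔ ∀ x : ℝ,
      M * ((1 + M * sigma α n) * ((1 + M * sigma α n) * diffOp (a₀ n) a (ultra n α) x
        - 2 * M * dividedBinom α n * diffOp (a₀ n) a (X * derivative (ultra n α)) x
        - 4 * dividedBinom α n * (derivative^[2] (ultra n α)).eval x)) = 0 := by
  refine forall_congr' fun x => ?_
  have h := diffOp_sub (a₀ n) a (C (C0 n α M) * ultra n α)
    (C (C1 n α M) * (X * derivative (ultra n α))) x
  rw [diffOp_C_mul, diffOp_C_mul] at h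
  have hy : a₀ n * (genUltra n α M).eval x
      + ∑' i : ℕ, a (i + 1) x * (derivative^[i + 1] (genUltra n α M)).eval x = _ := h
  rw [hy]
  have o0 := eval_ode_iterate n α x 0
  have o1 := eval_ode_iterate n α x 1
  have e1 : derivative (genUltra n α M) = C (C0 n α M) * derivative (ultra n α)
      - C (C1 n α M) * (derivative (ultra n α) + X * derivative^[2] (ultra n α)) := by
    simp [genUltra]
  have e2 : derivative^[2] (genUltra n α M) = C (C0 n α M) * derivative^[2] (ultra n α)
      - C (C1 n α M) * (2 * derivative^[2] (ultra n α) + X * derivative^[3] (ultra n α)) := by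
    rw [Function.iterate_succ_apply', Function.iterate_one, e1]
    simp
    left
    ring
  rw [e1, e2, genUltra]
  simp only [eval_sub, eval_add, eval_mul, eval_C, eval_X, eval_ofNat]
  push_cast at o0 o1
  simp only [zero_add, Function.iterate_zero, id, Function.iterate_one] at o0 o1
  rw [C0_eq hα, C1_eq]
  refine Eq.congr ?_ rfl
  linear_combination (1 + M * sigma α n) ^ 2 * o0
    - 2 * M * dividedBinom α n * (1 + M * sigma α n) * x * o1

theorem satisfiesDE_b_c {α : ℝ} (hα : -1 < α) (t M : ℝ) (n : ℕ) :
    SatisfiesDE α M (fun n => t * b₀ n + c₀ α n) (fun i x => t * b i x + c α i x) n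
      (genUltra n α M) := by
  rw [satisfiesDE_genUltra_iff hα]
  intro x
  have hdeg : (ultra n α).natDegree < n + 1 := Nat.lt_succ_of_le (natDegree_ultra_le n α)
  have hp := ultra_comp_neg n hα
  rw [diffOp_coeff_add, diffOp_coeff_add, diffOp_b_eq_zero hp,
    diffOp_b_eq_zero (X_mul_derivative_comp_neg hp), diffOp_c α _ x hdeg,
    diffOp_c α _ x ((natDegree_X_mul_derivative_le _).trans_lt hdeg), c₀_add_genSum_ultra hα,
    c₀_add_genSum_X_mul_derivative hα, sigma]
  ring

theorem diffOp_of_satisfiesDE {α : ℝ} (hα : -1 < α) {a₀ : ℕ → ℝ} {a : ℕ → ℝ → ℝ} {n : ℕ}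
    (h : ∀ M : ℝ, 0 ≤ M → SatisfiesDE α M a₀ a n (genUltra n α M)) (x : ℝ) :
    diffOp (a₀ n) a (ultra n α) x
      = 4 * dividedBinom α n * (derivative^[2] (ultra n α)).eval x ∧
    diffOp (a₀ n) a (X * derivative (ultra n α)) x
      = 2 * sigma α n * (derivative^[2] (ultra n α)).eval x := by
  have hs := sigma_nonneg hα n
  have key (M : ℝ) (hM : 0 < M) := (satisfiesDE_genUltra_iff hα M a₀ a n).mp (h M hM.le) x
  have h1 := key 1 one_pos
  have h2 := key 2 two_pos
  simp only [mul_eq_zero, one_ne_zero, two_ne_zero, false_or,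
    (by positivity : 1 + 1 * sigma α n ≠ 0), (by positivity : 1 + 2 * sigma α n ≠ 0)] at h1 h2
  have hQ : diffOp (a₀ n) a (ultra n α) x
      = 4 * dividedBinom α n * (derivative^[2] (ultra n α)).eval x := by
    -- Extrapolates the affine bracket from M = 1, 2 to M = 0.
    linear_combination 2 * h1 - h2
  refine ⟨hQ, ?_⟩
  rcases n with _ | n
  -- For n = 0 positivity of ρ is unavailable, but xQ' = 0 and Q'' = 0.
  · simp [diffOp, ultra_zero, sigma, iterate_derivative_eq_zero]
  · have hr := (dividedBinom_pos hα n).ne'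
    apply mul_left_cancel₀ hr
    rw [hQ] at h1
    linear_combination (-1 / 2 : ℝ) * h1

/-! ### Uniqueness -/

/-- With n = m+2, the coefficient of xᵐ in nQ - xQ' is twice that of Q. Were it zero, the
differential equation would make the leading coefficient of Q vanish. -/
theorem exists_eval_ne_zero {α : ℝ} (hα : -1 < α) (m : ℕ) :
    ∃ x, (C ((m + 2 : ℕ) : ℝ) * ultra (m + 2) α
      - X * derivative (ultra (m + 2) α)).eval x ≠ 0 := by
  by_contra! hx
  have h0 := congrArg (fun p => coeff p m)
    (Polynomial.funext fun x => (hx x).trans eval_zero.symm)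
  have hX : (X * derivative (ultra (m + 2) α)).coeff m = m * (ultra (m + 2) α).coeff m := by
    rcases m with _ | m
    · simp
    · rw [coeff_X_mul, coeff_derivative]
      push_cast
      ring
  simp only [coeff_sub, coeff_C_mul, hX, coeff_zero] at h0
  have h1 := coeff_of_ode (ultra_ode (m + 2) α) m
  have h2 := coeff_ultra_pos (m + 2) α hα
  push_cast at h0
  have h3 : (ultra (m + 2) α).coeff m = 0 := by linarith
  rw [h3, mul_zero, add_zero] at h1
  have h4 : 0 < ((m : ℝ) + 2) * (m + 1) * (ultra (m + 2) α).coeff (m + 2) := by positivity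
  exact h4.ne' h1

theorem natDegree_sub_X_mul_derivative_le {y : ℝ[X]} {n : ℕ} (hy : y.natDegree ≤ n + 1) :
    (C ((n + 1 : ℕ) : ℝ) * y - X * derivative y).natDegree ≤ n := by
  rw [natDegree_le_iff_coeff_eq_zero]
  intro k hk
  obtain ⟨k, rfl⟩ : ∃ j, k = j + 1 := ⟨k - 1, by omega⟩
  rw [coeff_sub, coeff_C_mul, coeff_X_mul, coeff_derivative]
  rcases eq_or_ne k n with rfl | hne
  · push_cast
    ring
  · rw [coeff_eq_zero_of_natDegree_lt (show y.natDegree < k + 1 by omega)]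
    ring

theorem eval_iterate_derivative_ultra_ne_zero {α : ℝ} (hα : -1 < α) (n : ℕ) (x : ℝ) :
    (derivative^[n] (ultra n α)).eval x ≠ 0 := by
  have hd : (derivative^[n] (ultra n α)).natDegree = 0 := by
    have h1 := natDegree_iterate_derivative (ultra n α) n
    have h2 := natDegree_ultra_le n α
    omega
  rw [eq_C_of_natDegree_eq_zero hd, eval_C, coeff_iterate_derivative, zero_add, nsmul_eq_mul,
    Nat.descFactorial_self]
  have := coeff_ultra_pos n α hα
  positivity

theorem eq_zero_of_diffOp_eq_zero {α : ℝ} (hα : -1 < α) {d₀ : ℕ → ℝ} {d : ℕ → ℝ → ℝ}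
    (h1 : d₀ 1 = 0) (hQ : ∀ n x, diffOp (d₀ n) d (ultra n α) x = 0)
    (hX : ∀ n x, diffOp (d₀ n) d (X * derivative (ultra n α)) x = 0) (n : ℕ) :
    d₀ n = 0 ∧ (1 ≤ n → ∀ x, d n x = 0) := by
  induction n using Nat.strong_induction_on with
  | _ n ih =>
    have hn : d₀ n = 0 := by
      rcases n with _ | _ | m
      · have h := hQ 0 0
        rw [diffOp_eq_sum (N := 0) _ _ (natDegree_ultra_le 0 α)] at h
        simpa [ultra_zero] using h
      -- For n = 1 the polynomial nQ - xQ' is zero and gives no information.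
      · exact h1
      · obtain ⟨x, hx⟩ := exists_eval_ne_zero hα m
        have h := diffOp_sub (d₀ (m + 2)) d (C ((m + 2 : ℕ) : ℝ) * ultra (m + 2) α)
          (X * derivative (ultra (m + 2) α)) x
        rw [diffOp_C_mul, hQ, hX, mul_zero, sub_zero, diffOp_eq_sum _ _
          (natDegree_sub_X_mul_derivative_le (natDegree_ultra_le (m + 2) α)),
          Finset.sum_eq_zero, add_zero] at h
        · exact (mul_eq_zero.mp h).resolve_right hx
        · intro i hi
          have hi : i < m + 1 := by simpa using hi
          rw [(ih (i + 1) (by omega)).2 (by omega), zero_mul]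
    refine ⟨hn, fun hn1 x => ?_⟩
    obtain ⟨m, rfl⟩ := Nat.exists_eq_add_of_le' hn1
    have h := hQ (m + 1) x
    rw [diffOp_eq_sum _ _ (natDegree_ultra_le (m + 1) α), hn, zero_mul, zero_add,
      Finset.sum_range_succ, Finset.sum_eq_zero, zero_add] at h
    · exact (mul_eq_zero.mp h).resolve_right (eval_iterate_derivative_ultra_ne_zero hα _ x)
    · intro i hi
      have hi : i < m := by simpa using hi
      rw [(ih (i + 1) (by omega)).2 (by omega), zero_mul]

end GenUltraspherical

theorem mainTheorem1 (α : ℝ) (hα : -1 < α) :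
    (∀ (a₀ : ℕ → ℝ) (a : ℕ → ℝ → ℝ),
      (∀ M : ℝ, 0 ≤ M → ∀ n : ℕ,
        GenUltraspherical.SatisfiesDE α M a₀ a n (GenUltraspherical.genUltra n α M)) →
      (∀ n : ℕ, a₀ n = a₀ 1 * GenUltraspherical.b₀ n + GenUltraspherical.c₀ α n) ∧
      (∀ i : ℕ, 1 ≤ i → ∀ x : ℝ,
        a i x = a₀ 1 * GenUltraspherical.b i x + GenUltraspherical.c α i x)) ∧
    (∀ t : ℝ, ∃ (a₀ : ℕ → ℝ) (a : ℕ → ℝ → ℝ),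
      a₀ 1 = t ∧
      (∀ n : ℕ, a₀ n = t * GenUltraspherical.b₀ n + GenUltraspherical.c₀ α n) ∧
      (∀ i : ℕ, 1 ≤ i → ∀ x : ℝ,
        a i x = t * GenUltraspherical.b i x + GenUltraspherical.c α i x) ∧
      (∀ M : ℝ, 0 ≤ M → ∀ n : ℕ,
        GenUltraspherical.SatisfiesDE α M a₀ a n (GenUltraspherical.genUltra n α M))) := by
  open GenUltraspherical in
  -- b₀(1) = 1 and c₀(1) = 0, so the parameter t is the value a₀(1).
  have hone (t : ℝ) : t * b₀ 1 + c₀ α 1 = t := by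
    norm_num [b₀, c₀, binom]
  refine ⟨fun a₀ a h => ?_, fun t => ⟨fun n => t * b₀ n + c₀ α n, fun i x => t * b i x + c α i x,
    hone t, fun _ => rfl, fun _ _ _ => rfl, fun M _ n => satisfiesDE_b_c hα t M n⟩⟩
  -- Subtract the explicit solution with parameter t = a₀(1); both satisfy the same two M-free
  -- equations.
  have key := eq_zero_of_diffOp_eq_zero hα
    (d₀ := fun n => a₀ n - (a₀ 1 * b₀ n + c₀ α n))
    (d := fun i x => a i x - (a₀ 1 * b i x + c α i x))
    (sub_eq_zero.mpr (hone _).symm)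
    (fun n x => by
      rw [diffOp_coeff_sub, (diffOp_of_satisfiesDE hα (fun M hM => h M hM n) x).1]
      exact sub_eq_zero.mpr
        (diffOp_of_satisfiesDE hα (fun M _ => satisfiesDE_b_c hα (a₀ 1) M n) x).1.symm)
    (fun n x => by
      rw [diffOp_coeff_sub, (diffOp_of_satisfiesDE hα (fun M hM => h M hM n) x).2]
      exact sub_eq_zero.mpr
        (diffOp_of_satisfiesDE hα (fun M _ => satisfiesDE_b_c hα (a₀ 1) M n) x).2.symm)
  exact ⟨fun n => sub_eq_zero.mp (key n).1, fun i hi x => sub_eq_zero.mp ((key i).2 hi x)⟩
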